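/- Let $K$ be a field and let $\alpha_1,\alpha_2,\alpha_3,\alpha_4>1$ and $\alpha_{21}>0$ be integers with $\alpha_{21}<\alpha_1-1$. Put $$n_1=\alpha_2\alpha_3(\alpha_4-1)+1,\qquad n_2=\alpha_{21}\alpha_3\alpha_4+(\alpha_1-\alpha_{21}-1)(\alpha_3-1)+\alpha_3,$$ $$n_3=\alpha_1\alpha_4+(\alpha_1-\alpha_{21}-1)(\alpha_2-1)(\alpha_4-1)-\alpha_4+1,\qquad n_4=\alpha_1\alpha_2(\alpha_3-1)+\alpha_{21}(\alpha_2-1)+\alpha_2,$$ and assume $\gcd(n_1,n_2,n_3,n_4)=1$. (By a theorem of Komeda, the semigroups $S=\langle n_1,n_2,n_3,n_4\rangle$ arising in this way are, up to the numbering of the generators, exactly the minimally 4-generated pseudo-symmetric numerical semigroups.) Let $A=K[X_1,X_2,X_3,X_4]$, let $I_S\subset A$ be the kernel of $A\to K[t]$, $X_i\mapsto t^{n_i}$, that is, the ideal of the monomial curve $C_S$, and let $I_{S*}$ be the ideal generated by the lowest-degree homogeneous summands $f_*$ of the elements $f\in I_S$, so that $A/I_{S*}$ is the coordinate ring of the tangent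 cone of $C_S$ at the origin. Put $$f_1=X_1^{\alpha_1}-X_3X_4^{\alpha_4-1},\quad f_2=X_2^{\alpha_2}-X_1^{\alpha_{21}}X_4,\quad f_3=X_3^{\alpha_3}-X_1^{\alpha_1-\alpha_{21}-1}X_2,$$ $$f_4=X_4^{\alpha_4}-X_1X_2^{\alpha_2-1}X_3^{\alpha_3-1},\quad f_5=X_3^{\alpha_3-1}X_1^{\alpha_{21}+1}-X_2X_4^{\alpha_4-1}.$$ Suppose $n_1$ is the smallest of $n_1,n_2,n_3,n_4$. Then the tangent cone of $C_S$ at the origin is Cohen–Macaulay, i.e. $A/I_{S*}$ is a Cohen–Macaulay ring, if and only if $$\alpha_2\le\alpha_{21}+1,\qquad \alpha_{21}+\alpha_3\le\alpha_1,\qquad \alpha_4\le\alpha_2+\alpha_3-1.$$ In that case $f_1,\dots,f_5$ form a minimal standard basis of $I_S$ with respect to every negative degree reverse lexicographic order in which $X_1$ is the smallest variable; that is, their leading monomials generate the ideal of leading monomials of $I_S$, and none of these five leading monomials divides another. -/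

import Mathlib

open MvPolynomial

/-- A (Noetherian) local ring is Cohen–Macaulay if its maximal ideal contains a regular sequence
whose length is the Krull dimension of the ring. -/
def IsCohenMacaulayLocal (R : Type*) [CommRing R] [IsLocalRing R] : Prop :=
  ∃ rs : List R, (∀ r ∈ rs, r ∈ IsLocalRing.maximalIdeal R) ∧
    RingTheory.Sequence.IsRegular R rs ∧ (rs.length : WithBot ℕ∞) = ringKrullDim R

/-- A Noetherian ring is Cohen–Macaulay if all its localizations at maximal ideals are
Cohen–Macaulay local rings. -/
def IsCohenMacaulay (R : Type*) [CommRing R] : Prop :=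
  IsNoetherianRing R ∧
    ∀ (p : Ideal R) [p.IsMaximal], IsCohenMacaulayLocal (Localization.AtPrime p)

/-- The ideal `I_S` of the monomial curve `X_i = t ^ n_i`: the kernel of
`K[X₁, …, X₄] → K[t]`, `X_i ↦ t ^ n_i`. The variable `X_i` of the text is `X (i - 1)`. -/
noncomputable def curveIdeal (K : Type*) [Field K] (n : Fin 4 → ℕ) :
    Ideal (MvPolynomial (Fin 4) K) :=
  RingHom.ker (aeval (fun i => (Polynomial.X : Polynomial K) ^ n i) :
    MvPolynomial (Fin 4) K →ₐ[K] Polynomial K)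

/-- The homogeneous summand `f_*` of least degree of `f` (with `0_* = 0`). -/
noncomputable def initialForm {K : Type*} [Field K] (f : MvPolynomial (Fin 4) K) :
    MvPolynomial (Fin 4) K :=
  homogeneousComponent (sInf {d : ℕ | homogeneousComponent d f ≠ 0}) f

/-- The defining ideal of the tangent cone at the origin of the zero set of `I`: it is generated
by the homogeneous summands of least degree of the elements of `I`. -/
noncomputable def tangentConeIdeal {K : Type*} [Field K] (I : Ideal (MvPolynomial (Fin 4) K)) :
    Ideal (MvPolynomial (Fin 4) K) :=
  Ideal.span (initialForm '' (I : Set (MvPolynomial (Fin 4) K)))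

/-- The negative degree reverse lexicographic order on exponent vectors, for the order of the
variables in which `X i` is smaller than `X j` iff `σ i < σ j`: the monomial `X ^ a` is smaller
than `X ^ b` iff it has larger total degree, or the degrees agree and, at the smallest variable
where the exponents differ, `a` has the larger exponent. -/
def NegDegRevLexLT (σ : Equiv.Perm (Fin 4)) (a b : Fin 4 →₀ ℕ) : Prop :=
  b.degree < a.degree ∨
    (a.degree = b.degree ∧ ∃ i, b i < a i ∧ ∀ j, σ j < σ i → a j = b j)

/-- `X ^ a` is the leading (that is, largest) monomial of `f`. -/
def IsLeadingExponent {K : Type*} [Field K] (σ : Equiv.Perm (Fin 4))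
    (f : MvPolynomial (Fin 4) K) (a : Fin 4 →₀ ℕ) : Prop :=
  a ∈ f.support ∧ ∀ b ∈ f.support, b ≠ a → NegDegRevLexLT σ b a

/-- The ideal generated by the leading monomials of the nonzero elements of `F`. -/
noncomputable def leadingIdeal {K : Type*} [Field K] (σ : Equiv.Perm (Fin 4))
    (F : Set (MvPolynomial (Fin 4) K)) : Ideal (MvPolynomial (Fin 4) K) :=
  Ideal.span {m | ∃ f ∈ F, ∃ a, IsLeadingExponent σ f a ∧ m = monomial a 1}

/-- The finite family `g` is a minimal standard basis of `I`: its members are nonzero elements of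
`I`, their leading monomials generate the leading ideal of `I`, and none of these leading
monomials divides another. -/
structure IsMinimalStandardBasis {K : Type*} [Field K] (σ : Equiv.Perm (Fin 4)) {r : ℕ}
    (g : Fin r → MvPolynomial (Fin 4) K) (I : Ideal (MvPolynomial (Fin 4) K)) : Prop where
  mem : ∀ i, g i ∈ I
  ne_zero : ∀ i, g i ≠ 0
  leadingIdeal_eq :
    leadingIdeal σ (Set.range g) = leadingIdeal σ (I : Set (MvPolynomial (Fin 4) K))
  not_dvd : ∀ i j, i ≠ j → ∀ a b, IsLeadingExponent σ (g i) a → IsLeadingExponent σ (g j) b →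
    ¬ (monomial a (1 : K) ∣ monomial b (1 : K))

/-- The binomials `f₁, …, f₅` attached to the integers `α₂₁, α₁, α₂, α₃, α₄`. -/
noncomputable def curveBinomials (K : Type*) [Field K] (α₂₁ α₁ α₂ α₃ α₄ : ℕ) :
    Fin 5 → MvPolynomial (Fin 4) K :=
  ![X 0 ^ α₁ - X 2 * X 3 ^ (α₄ - 1),
    X 1 ^ α₂ - X 0 ^ α₂₁ * X 3,
    X 2 ^ α₃ - X 0 ^ (α₁ - α₂₁ - 1) * X 1,
    X 3 ^ α₄ - X 0 * X 1 ^ (α₂ - 1) * X 2 ^ (α₃ - 1),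
    X 2 ^ (α₃ - 1) * X 0 ^ (α₂₁ + 1) - X 1 * X 3 ^ (α₄ - 1)]

/-! Give `X i` weight `n i`. The ideal `I_{S*}` is spanned by the monomials whose degree is not the
largest for their weight and by the differences of monomials of equal weight and degree. So it is
the kernel of `coneMap`, and the quotient has one basis monomial for each element of the semigroup.

Since `n 0` is minimal, the quotient is integral over `K[X 0]`, and it is Cohen–Macaulay exactly
when `X 0` is a nonzerodivisor on it, i.e. when multiplication by `X 0` preserves `IsMaxDegree`. If
so, the quotient is torsion-free over `K[X 0]`. Conversely, the Cohen–Macaulay property at the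
origin leaves no socle, and anything killed by `X 0` is killed by a power of the origin's ideal,
hence zero.

The rest is combinatorial. Rewriting by the five binomials, always towards a higher power of `X 0`,
reaches a standard exponent. Up to powers of `X 0` there are exactly `n 0` of these and they cover
all residues mod `n 0`, so each weight has only one (`standard_unique`). Rewriting never lowers the
degree iff the three inequalities hold, given that `n 0` is minimal. Uniqueness also yields the
standard basis. -/

/-! ### Cohen–Macaulay criteria in dimension one -/

theorem isCohenMacaulayLocal_of_nonZeroDivisor {R : Type*} [CommRing R] [IsLocalRing R]
    [IsNoetherianRing R] {x : R} (hx : x ∈ nonZeroDivisors R)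
    (hxm : x ∈ IsLocalRing.maximalIdeal R)
    (hP : ∀ P : Ideal R, P.IsPrime → x ∈ P → P = IsLocalRing.maximalIdeal R) :
    IsCohenMacaulayLocal R := by
  have hreg : IsSMulRegular R x := by
    intro a b hab
    simp only [smul_eq_mul] at hab
    exact (mul_cancel_left_mem_nonZeroDivisors hx).1 hab
  refine ⟨[x], by simpa using hxm, ?_, ?_⟩
  · rw [IsLocalRing.isRegular_iff_isWeaklyRegular_of_subset_maximalIdeal (by simpa using hxm)]
    rwa [RingTheory.Sequence.isWeaklyRegular_singleton_iff]
  · have : Nontrivial (R ⧸ Ideal.span {x}) :=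
      Ideal.Quotient.nontrivial_iff.2 fun h => (IsLocalRing.maximalIdeal.isMaximal R).ne_top
        (top_le_iff.1 (h ▸ (Ideal.span_singleton_le_iff_mem _).2 hxm))
    -- Only the maximal ideal contains `x`, so the quotient has dimension 0 and `R` has dimension 1,
    -- the length of `[x]`.
    have h0 : ringKrullDim (R ⧸ Ideal.span {x}) = 0 := by
      rw [← ringKrullDimZero_iff_ringKrullDim_eq_zero,
        Ideal.krullDimLE_zero_quotient_iff_forall_minimalPrimes_isMaximal]
      intro P hPm
      have := hP P hPm.1.1 (hPm.1.2 (Ideal.mem_span_singleton_self x))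
      rw [this]
      infer_instance
    rw [← ringKrullDim_quotient_span_singleton_succ_eq_ringKrullDim hreg hxm, h0]
    simp

/-- A maximal ideal contracts to a nonzero ideal of `K[X]`; take `g ≠ 0` in it. Then `φ g` is a
nonzerodivisor, and any prime containing it contracts to a nonzero, hence maximal, ideal, so by
integrality it is itself maximal. -/
theorem isCohenMacaulay_of_isIntegral_polynomial {K R : Type*} [Field K] [CommRing R]
    [IsNoetherianRing R] (φ : Polynomial K →+* R) (hφ : φ.IsIntegral)
    (htf : ∀ g : Polynomial K, g ≠ 0 → ∀ h : R, φ g * h = 0 → h = 0) :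
    IsCohenMacaulay R := by
  refine ⟨inferInstance, fun p hp => ?_⟩
  have hq : (p.comap φ).IsMaximal := Ideal.isMaximal_comap_of_isIntegral_of_isMaximal' φ hφ p
  have hqb : p.comap φ ≠ ⊥ := Ring.ne_bot_of_isMaximal_of_not_isField hq
    (Polynomial.not_isField K)
  obtain ⟨g, hg, hg0⟩ := Submodule.exists_mem_ne_zero_of_ne_bot hqb
  have hreg : φ g ∈ nonZeroDivisors R := by
    rw [mem_nonZeroDivisors_iff_right]
    intro z hz
    exact htf g hg0 z (by rwa [mul_comm])
  have : IsNoetherianRing (Localization.AtPrime p) :=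
    IsLocalization.isNoetherianRing p.primeCompl _ inferInstance
  refine isCohenMacaulayLocal_of_nonZeroDivisor (x := algebraMap R _ (φ g)) ?_ ?_ ?_
  · exact IsLocalization.map_nonZeroDivisors_le p.primeCompl _ (Submonoid.mem_map_of_mem _ hreg)
  · rw [← Localization.AtPrime.map_eq_maximalIdeal]
    exact Ideal.mem_map_of_mem _ hg
  · intro P hPp hxP
    have hP' : (P.comap (algebraMap R (Localization.AtPrime p))).IsPrime := hPp.comap _
    set P' := P.comap (algebraMap R (Localization.AtPrime p)) with hP'def
    have hgP : g ∈ P'.comap φ := hxP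
    have hmax : (P'.comap φ).IsMaximal :=
      IsPrime.to_maximal_ideal (hpi := hP'.comap φ) fun h => hg0 (by rw [h] at hgP; simpa using hgP)
    have hP'max : P'.IsMaximal := by
      let _ := φ.toAlgebra
      have : Algebra.IsIntegral (Polynomial K) R := ⟨hφ⟩
      exact Ideal.isMaximal_of_isIntegral_of_isMaximal_comap P' hmax
    have hle : P' ≤ p := by
      intro r hr
      by_contra hrp
      refine hPp.ne_top (Ideal.eq_top_of_isUnit_mem _ hr ?_)
      exact IsLocalization.map_units (Localization.AtPrime p) (⟨r, hrp⟩ : p.primeCompl)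
    have hPeq : P' = p := hP'max.eq_of_le hp.ne_top hle
    rw [← Localization.AtPrime.map_eq_maximalIdeal]
    conv_rhs => arg 2; rw [← hPeq]
    exact (IsLocalization.map_under p.primeCompl _ P).symm

/-- In a Cohen–Macaulay ring, a maximal ideal whose localization has a non-nilpotent element in its
maximal ideal does not annihilate a nonzero element. -/
theorem IsCohenMacaulay.eq_zero_of_maximal_mul_eq_zero {R : Type*} [CommRing R]
    (hR : IsCohenMacaulay R) (p : Ideal R) [p.IsMaximal] {x : R} (hx : x ∈ p)
    (hnil : ∀ k : ℕ, ∀ s ∉ p, s * x ^ k ≠ 0) {z : R} (hz : ∀ y ∈ p, y * z = 0) : z = 0 := by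
  have := hR.1
  obtain ⟨rs, hrs, hreg, hdim⟩ := hR.2 p
  cases rs with
  | nil =>
    -- An empty regular sequence forces dimension 0, which makes the maximal ideal nil, against
    -- `hnil`.
    exfalso
    have h0 : Ring.KrullDimLE 0 (Localization.AtPrime p) :=
      ringKrullDimZero_iff_ringKrullDim_eq_zero.2 (by simpa using hdim.symm)
    have hxm : algebraMap R (Localization.AtPrime p) x ∈ IsLocalRing.maximalIdeal _ := by
      rw [← Localization.AtPrime.map_eq_maximalIdeal]
      exact Ideal.mem_map_of_mem _ hx
    have : IsNilpotent (algebraMap R (Localization.AtPrime p) x) := by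
      rw [← mem_nilradical, ← Ring.jacobson_eq_nilradical_of_krullDimLE_zero,
        IsLocalRing.ringJacobson_eq_maximalIdeal]
      exact hxm
    obtain ⟨k, hk⟩ := this
    rw [← map_pow, IsLocalization.map_eq_zero_iff p.primeCompl] at hk
    obtain ⟨s, hs⟩ := hk
    exact hnil k s s.2 hs
  | cons r rs =>
    -- The first term is a nonzerodivisor in the maximal ideal, yet that ideal kills `z`; so `z`
    -- vanishes locally, and then globally because `p` is maximal.
    have hr := ((RingTheory.Sequence.isRegular_cons_iff _ _ _).1 hreg).1
    have hrm := hrs r (by simp)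
    have hz0 : algebraMap R (Localization.AtPrime p) z = 0 := by
      apply hr
      simp only [smul_eq_mul, mul_zero]
      rw [← Localization.AtPrime.map_eq_maximalIdeal] at hrm
      refine Submodule.span_induction
        (p := fun r _ => r * algebraMap R (Localization.AtPrime p) z = 0) ?_ ?_ ?_ ?_ hrm
      · rintro _ ⟨y, hy, rfl⟩
        rw [← map_mul, hz y hy, map_zero]
      · simp
      · intro a b _ _ ha hb
        rw [add_mul, ha, hb, add_zero]
      · intro a b _ hb
        rw [smul_eq_mul, mul_assoc, hb, mul_zero]
    rw [IsLocalization.map_eq_zero_iff p.primeCompl] at hz0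
    obtain ⟨s, hs⟩ := hz0
    obtain ⟨a, y, hy, hay⟩ := Ideal.IsMaximal.exists_inv ‹p.IsMaximal› s.2
    calc z = (a * s + y) * z := by rw [hay, one_mul]
      _ = 0 := by rw [add_mul, mul_assoc, hs, hz y hy, mul_zero, add_zero]

/-! ### Weights, degrees and exponents of maximal degree -/

theorem weight_fin_four (n : Fin 4 → ℕ) (e : Fin 4 →₀ ℕ) :
    Finsupp.weight n e = e 0 * n 0 + e 1 * n 1 + e 2 * n 2 + e 3 * n 3 := by
  rw [Finsupp.weight_apply, Finsupp.sum_fintype _ _ (by simp), Fin.sum_univ_four]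
  simp

theorem degree_fin_four (e : Fin 4 →₀ ℕ) : e.degree = e 0 + e 1 + e 2 + e 3 := by
  rw [Finsupp.degree_eq_sum, Fin.sum_univ_four]

theorem degree_mul_le_weight {n : Fin 4 → ℕ} {m : ℕ} (hm : ∀ i, m ≤ n i) (e : Fin 4 →₀ ℕ) :
    e.degree * m ≤ Finsupp.weight n e := by
  rw [weight_fin_four, degree_fin_four, add_mul, add_mul, add_mul]
  gcongr <;> exact hm _

theorem degree_le_weight {n : Fin 4 → ℕ} (hn : ∀ i, 0 < n i) (e : Fin 4 →₀ ℕ) :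
    e.degree ≤ Finsupp.weight n e := by
  simpa using degree_mul_le_weight (m := 1) hn e

theorem eq_zero_of_weight_eq_zero {n : Fin 4 → ℕ} (hn : ∀ i, 0 < n i) {e : Fin 4 →₀ ℕ}
    (he : Finsupp.weight n e = 0) : e = 0 := by
  have := degree_le_weight hn e
  exact (Finsupp.degree_eq_zero_iff e).1 (by omega)

/-- The exponent `e` has the largest degree among all exponents of the same weight. -/
def IsMaxDegree (n : Fin 4 → ℕ) (e : Fin 4 →₀ ℕ) : Prop :=
  ∀ v, Finsupp.weight n v = Finsupp.weight n e → v.degree ≤ e.degree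

theorem IsMaxDegree.congr {n : Fin 4 → ℕ} {e v : Fin 4 →₀ ℕ} (he : IsMaxDegree n e)
    (hw : Finsupp.weight n v = Finsupp.weight n e) (hd : e.degree ≤ v.degree) :
    IsMaxDegree n v := fun u hu => (he u (hu.trans hw)).trans hd

theorem IsMaxDegree.of_add {n : Fin 4 → ℕ} {u e : Fin 4 →₀ ℕ} (h : IsMaxDegree n (u + e)) :
    IsMaxDegree n e := by
  intro v hv
  have := h (u + v) (by simp [hv])
  simpa using this

theorem exists_isMaxDegree {n : Fin 4 → ℕ} (hn : ∀ i, 0 < n i) (e : Fin 4 →₀ ℕ) :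
    ∃ v, Finsupp.weight n v = Finsupp.weight n e ∧ e.degree ≤ v.degree ∧ IsMaxDegree n v := by
  induction h : Finsupp.weight n e - e.degree using Nat.strong_induction_on generalizing e with
  | _ N ih =>
    by_cases he : IsMaxDegree n e
    · exact ⟨e, rfl, le_rfl, he⟩
    · unfold IsMaxDegree at he
      push Not at he
      obtain ⟨v, hv, hlt⟩ := he
      have h1 := degree_le_weight hn v
      obtain ⟨u, hu, hd, hmax⟩ := ih _ (by omega) v rfl
      exact ⟨u, hu.trans hv, by omega, hmax⟩

/-! ### The tangent cone ideal as the kernel of `coneMap` -/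

section
variable {K : Type*} [Field K] {n : Fin 4 → ℕ}

theorem aeval_monomial_curve (e : Fin 4 →₀ ℕ) (c : K) :
    aeval (fun i => (Polynomial.X : Polynomial K) ^ n i) (monomial e c) =
      Polynomial.monomial (Finsupp.weight n e) c := by
  rw [aeval_monomial, Finsupp.prod_fintype _ _ (by simp), Fin.prod_univ_four, weight_fin_four,
    ← Polynomial.C_mul_X_pow_eq_monomial]
  simp only [← pow_mul, Polynomial.algebraMap_eq, ← pow_add]
  congr 2
  ring

theorem coeff_aeval_curve (f : MvPolynomial (Fin 4) K) (w : ℕ) :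
    (aeval (fun i => (Polynomial.X : Polynomial K) ^ n i) f).coeff w =
      ∑ e ∈ f.support, if Finsupp.weight n e = w then coeff e f else 0 := by
  conv_lhs => rw [f.as_sum, map_sum, Polynomial.finsetSum_coeff]
  refine Finset.sum_congr rfl fun e _ => ?_
  rw [aeval_monomial_curve, Polynomial.coeff_monomial]

theorem sum_coeff_eq_zero_of_mem_curveIdeal {f : MvPolynomial (Fin 4) K}
    (hf : f ∈ curveIdeal K n) (w : ℕ) :
    ∑ e ∈ f.support, (if Finsupp.weight n e = w then coeff e f else 0) = 0 := by
  rw [← coeff_aeval_curve, (RingHom.mem_ker).1 hf, Polynomial.coeff_zero]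

theorem monomial_sub_monomial_mem_curveIdeal {a b : Fin 4 →₀ ℕ}
    (h : Finsupp.weight n a = Finsupp.weight n b) :
    monomial a (1 : K) - monomial b 1 ∈ curveIdeal K n := by
  unfold curveIdeal
  rw [RingHom.mem_ker, map_sub, aeval_monomial_curve, aeval_monomial_curve, h, sub_self]

open Classical in
/-- The linear map sending a monomial of weight `w` to `t ^ w` if its degree is the largest possible
for its weight, and to zero otherwise. Its kernel is the ideal of the tangent cone. -/
noncomputable def coneMap (K : Type*) [Field K] (n : Fin 4 → ℕ) :
    MvPolynomial (Fin 4) K →ₗ[K] Polynomial K :=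
  (basisMonomials (Fin 4) K).constr K
    (fun e => if IsMaxDegree n e then Polynomial.monomial (Finsupp.weight n e) 1 else 0)

open Classical in
theorem coneMap_monomial (e : Fin 4 →₀ ℕ) (c : K) :
    coneMap K n (monomial e c) =
      if IsMaxDegree n e then Polynomial.monomial (Finsupp.weight n e) c else 0 := by
  have h1 : coneMap K n (monomial e 1) =
      if IsMaxDegree n e then Polynomial.monomial (Finsupp.weight n e) 1 else 0 := by
    have := (basisMonomials (Fin 4) K).constr_basis K
      (fun e => if IsMaxDegree n e then Polynomial.monomial (Finsupp.weight n e) (1 : K) else 0) e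
    rwa [coe_basisMonomials] at this
  have h2 : (monomial e c : MvPolynomial (Fin 4) K) = c • monomial e 1 := by
    rw [smul_monomial, smul_eq_mul, mul_one]
  rw [h2, map_smul, h1]
  split_ifs
  · rw [Polynomial.smul_monomial, smul_eq_mul, mul_one]
  · simp

theorem initialForm_eq_sum (f : MvPolynomial (Fin 4) K) : ∃ d, (∀ e ∈ f.support, d ≤ e.degree) ∧
    initialForm f = ∑ e ∈ f.support with e.degree = d, monomial e (coeff e f) := by
  refine ⟨_, fun e he => ?_, homogeneousComponent_apply _ _⟩
  refine Nat.sInf_le fun h => ?_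
  have := coeff_homogeneousComponent (n := e.degree) (φ := f) e
  rw [h, if_pos rfl, coeff_zero] at this
  exact (mem_support_iff.1 he) this.symm

/-- If `u + e₀` has maximal degree then so does `e₀`; hence, when `e₀` has the least degree
occurring in `f`, all terms of `f` of its weight lie in the initial form, and their coefficients sum
to zero. The factor `monomial u c` is carried along because the kernel of a linear map is not yet
known to be an ideal. -/
theorem coneMap_monomial_mul_initialForm {f : MvPolynomial (Fin 4) K}
    (hf : f ∈ curveIdeal K n) (u : Fin 4 →₀ ℕ) (c : K) :
    coneMap K n (monomial u c * initialForm f) = 0 := by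
  classical
  obtain ⟨d, hd, hsum⟩ := initialForm_eq_sum f
  rw [hsum, Finset.mul_sum, map_sum]
  simp only [monomial_mul, coneMap_monomial]
  ext w
  rw [Polynomial.finsetSum_coeff, Polynomial.coeff_zero]
  by_cases hex : ∃ e₀, e₀.degree = d ∧ IsMaxDegree n (u + e₀) ∧ Finsupp.weight n (u + e₀) = w
  · obtain ⟨e₀, hd₀, hmax, hw⟩ := hex
    have hz := sum_coeff_eq_zero_of_mem_curveIdeal hf (Finsupp.weight n e₀)
    have hz' := congrArg (c * ·) hz
    simp only [mul_zero, Finset.mul_sum] at hz'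
    rw [← hz', Finset.sum_filter]
    refine Finset.sum_congr rfl fun e he => ?_
    have hde := hd e he
    by_cases hwe : Finsupp.weight n e = Finsupp.weight n e₀
    · have hw' : Finsupp.weight n (u + e) = Finsupp.weight n (u + e₀) := by simp [hwe]
      have hle := hmax.of_add e hwe
      have hmax' : IsMaxDegree n (u + e) := hmax.congr hw' (by simp; omega)
      rw [if_pos (by omega), if_pos hmax', if_pos hwe, hw', hw, Polynomial.coeff_monomial_same]
    · have hw' : Finsupp.weight n (u + e) ≠ w := by
        rw [← hw]
        simpa using hwe
      rw [if_neg hwe, mul_zero]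
      split_ifs
      · rw [Polynomial.coeff_monomial, if_neg hw']
      · simp
      · rfl
  · refine Finset.sum_eq_zero fun e he => ?_
    split_ifs with hmax
    · rw [Polynomial.coeff_monomial, if_neg]
      exact fun hw => hex ⟨e, (Finset.mem_filter.1 he).2, hmax, hw⟩
    · simp

theorem coneMap_mul_eq_zero_of_mem {h : MvPolynomial (Fin 4) K}
    (hh : h ∈ tangentConeIdeal (curveIdeal K n)) (q : MvPolynomial (Fin 4) K) :
    coneMap K n (q * h) = 0 := by
  unfold tangentConeIdeal at hh
  induction hh using Submodule.span_induction generalizing q with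
  | mem h hh =>
    obtain ⟨f, hf, rfl⟩ := hh
    induction q using MvPolynomial.induction_on' with
    | monomial u c => exact coneMap_monomial_mul_initialForm hf u c
    | add p q hp hq => rw [add_mul, map_add, hp, hq, add_zero]
  | zero => simp
  | add a b _ _ ha hb => rw [mul_add, map_add, ha, hb, add_zero]
  | smul a b _ hb => rw [smul_eq_mul, ← mul_assoc, hb]

theorem initialForm_eq {f : MvPolynomial (Fin 4) K} {e : Fin 4 →₀ ℕ} (he : e ∈ f.support)
    (hlow : ∀ v ∈ f.support, e.degree ≤ v.degree) :
    initialForm f = homogeneousComponent e.degree f := by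
  have hd : sInf {d : ℕ | homogeneousComponent d f ≠ 0} = e.degree := by
    apply le_antisymm
    · refine Nat.sInf_le fun h => ?_
      have := coeff_homogeneousComponent (n := e.degree) (φ := f) e
      rw [h, if_pos rfl, coeff_zero] at this
      exact (mem_support_iff.1 he) this.symm
    · refine le_csInf ⟨e.degree, fun h => ?_⟩ fun d hd => ?_
      · have := coeff_homogeneousComponent (n := e.degree) (φ := f) e
        rw [h, if_pos rfl, coeff_zero] at this
        exact (mem_support_iff.1 he) this.symm
      · by_contra hlt
        refine hd (homogeneousComponent_eq_zero' _ _ fun v hv => ?_)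
        have := hlow v hv
        omega
  rw [initialForm, hd]

theorem initialForm_monomial_sub_monomial {a b : Fin 4 →₀ ℕ} (hab : a ≠ b)
    (hd : a.degree ≤ b.degree) :
    initialForm (monomial a (1 : K) - monomial b 1) =
      if a.degree = b.degree then monomial a (1 : K) - monomial b 1 else monomial a 1 := by
  classical
  have ha : a ∈ (monomial a (1 : K) - monomial b 1).support := by
    rw [mem_support_iff, coeff_sub, coeff_monomial, coeff_monomial, if_pos rfl, if_neg hab.symm]
    simp
  rw [initialForm_eq ha]
  · ext v
    rw [coeff_homogeneousComponent]
    by_cases hva : v = a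
    · subst hva
      rw [if_pos rfl]
      split_ifs <;> simp [hab.symm]
    · by_cases hvb : v = b
      · subst hvb
        by_cases h : a.degree = v.degree
        · simp [h]
        · rw [if_neg (Ne.symm h), if_neg h, coeff_monomial, if_neg hab]
      · split_ifs <;> simp [Ne.symm hva, Ne.symm hvb]
  · intro v hv
    rw [mem_support_iff, coeff_sub, coeff_monomial, coeff_monomial] at hv
    split_ifs at hv with h1 h2 h2
    · rw [h1]
    · rw [h1]
    · rwa [← h2]
    · simp at hv

theorem monomial_mem_tangentConeIdeal {a b : Fin 4 →₀ ℕ}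
    (hw : Finsupp.weight n a = Finsupp.weight n b) (hd : a.degree < b.degree) (c : K) :
    monomial a c ∈ tangentConeIdeal (curveIdeal K n) := by
  have hab : a ≠ b := fun h => hd.ne (by rw [h])
  have h1 : monomial a (1 : K) ∈ tangentConeIdeal (curveIdeal K n) := by
    refine Ideal.subset_span ⟨_, monomial_sub_monomial_mem_curveIdeal hw, ?_⟩
    rw [initialForm_monomial_sub_monomial hab hd.le, if_neg hd.ne]
  have := Ideal.mul_mem_left _ (C c) h1
  rwa [C_mul_monomial, mul_one] at this

theorem monomial_sub_monomial_mem_tangentConeIdeal {a b : Fin 4 →₀ ℕ}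
    (hw : Finsupp.weight n a = Finsupp.weight n b) (hd : a.degree = b.degree) (c : K) :
    monomial a c - monomial b c ∈ tangentConeIdeal (curveIdeal K n) := by
  by_cases hab : a = b
  · simp [hab]
  have h1 : monomial a (1 : K) - monomial b 1 ∈ tangentConeIdeal (curveIdeal K n) := by
    refine Ideal.subset_span ⟨_, monomial_sub_monomial_mem_curveIdeal hw, ?_⟩
    rw [initialForm_monomial_sub_monomial hab hd.le, if_pos hd]
  have := Ideal.mul_mem_left _ (C c) h1
  rwa [mul_sub, C_mul_monomial, C_mul_monomial, mul_one] at this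

/-- Choosing one exponent `M w` of maximal degree per weight gives a linear map `L` back to
polynomials such that `q` and `L (coneMap K n q)` agree modulo the ideal. The default value of `M`
off the semigroup plays no role. -/
theorem mem_tangentConeIdeal_of_coneMap_eq_zero (hn : ∀ i, 0 < n i)
    {h : MvPolynomial (Fin 4) K} (hh : coneMap K n h = 0) :
    h ∈ tangentConeIdeal (curveIdeal K n) := by
  classical
  have hM : ∀ w, ∃ v, (∃ e : Fin 4 →₀ ℕ, Finsupp.weight n e = w) →
      Finsupp.weight n v = w ∧ IsMaxDegree n v := by
    intro w
    by_cases hw : ∃ e : Fin 4 →₀ ℕ, Finsupp.weight n e = w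
    · obtain ⟨e, rfl⟩ := hw
      obtain ⟨v, hv, -, hmax⟩ := exists_isMaxDegree hn e
      exact ⟨v, fun _ => ⟨hv, hmax⟩⟩
    · exact ⟨0, fun h => (hw h).elim⟩
  choose M hM using hM
  let L : Polynomial K →ₗ[K] MvPolynomial (Fin 4) K :=
    (Polynomial.basisMonomials K).constr K (fun w => monomial (M w) 1)
  have hL : ∀ w (c : K), L (Polynomial.monomial w c) = monomial (M w) c := by
    intro w c
    have h1 : L (Polynomial.monomial w 1) = monomial (M w) 1 := by
      have := (Polynomial.basisMonomials K).constr_basis K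
        (fun w => (monomial (M w) 1 : MvPolynomial (Fin 4) K)) w
      rwa [Polynomial.coe_basisMonomials] at this
    have h2 : Polynomial.monomial w c = c • Polynomial.monomial w (1 : K) := by
      rw [Polynomial.smul_monomial, smul_eq_mul, mul_one]
    rw [h2, map_smul, h1, smul_monomial, smul_eq_mul, mul_one]
  have key : ∀ q, q - L (coneMap K n q) ∈ tangentConeIdeal (curveIdeal K n) := by
    intro q
    induction q using MvPolynomial.induction_on' with
    | monomial e c =>
      obtain ⟨hw, hmax⟩ := hM (Finsupp.weight n e) ⟨e, rfl⟩
      rw [coneMap_monomial]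
      split_ifs with he
      · rw [hL]
        exact monomial_sub_monomial_mem_tangentConeIdeal hw.symm
          (le_antisymm (hmax e hw.symm) (he _ hw)) c
      · rw [map_zero, sub_zero]
        refine monomial_mem_tangentConeIdeal hw.symm
          (lt_of_le_of_ne (hmax e hw.symm) fun hd => ?_) c
        exact he (hmax.congr hw.symm hd.ge)
    | add p q hp hq =>
      rw [map_add, map_add, add_sub_add_comm]
      exact Ideal.add_mem _ hp hq
  simpa [hh] using key h

theorem mem_tangentConeIdeal_iff (hn : ∀ i, 0 < n i) {h : MvPolynomial (Fin 4) K} :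
    h ∈ tangentConeIdeal (curveIdeal K n) ↔ coneMap K n h = 0 :=
  ⟨fun hh => by simpa using coneMap_mul_eq_zero_of_mem hh 1,
    mem_tangentConeIdeal_of_coneMap_eq_zero hn⟩

theorem monomial_mem_tangentConeIdeal_iff (hn : ∀ i, 0 < n i) {e : Fin 4 →₀ ℕ} :
    monomial e (1 : K) ∈ tangentConeIdeal (curveIdeal K n) ↔ ¬ IsMaxDegree n e := by
  classical
  rw [mem_tangentConeIdeal_iff hn, coneMap_monomial]
  split_ifs with h <;> simp [h]

/-- Compare `X i ^ n 0` with `X 0 ^ n i`, of equal weight: `c` is 0 if `n 0 < n i` and 1 if they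
coincide. This makes the quotient integral over `K[X 0]`. -/
theorem X_pow_sub_mem_tangentConeIdeal (hmin : ∀ i, n 0 ≤ n i) (i : Fin 4) :
    ∃ c : K, X i ^ n 0 - C c * X 0 ^ n 0 ∈ tangentConeIdeal (curveIdeal K n) := by
  have hw : Finsupp.weight n (Finsupp.single i (n 0)) =
      Finsupp.weight n (Finsupp.single 0 (n i)) := by
    simp [Finsupp.weight_single, mul_comm]
  rcases (hmin i).lt_or_eq with h | h
  · refine ⟨0, ?_⟩
    rw [C_0, zero_mul, sub_zero, X_pow_eq_monomial]
    exact monomial_mem_tangentConeIdeal hw (by simpa using h) 1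
  · refine ⟨1, ?_⟩
    rw [C_1, one_mul, X_pow_eq_monomial, X_pow_eq_monomial]
    rw [← h] at hw
    exact monomial_sub_monomial_mem_tangentConeIdeal hw (by simp) 1

/-! ### Cohen–Macaulayness and multiplication by `X 0` -/

theorem coneMap_X_mul (hX : ∀ e, IsMaxDegree n e → IsMaxDegree n (Finsupp.single 0 1 + e))
    (h : MvPolynomial (Fin 4) K) :
    coneMap K n (X 0 * h) = Polynomial.X ^ n 0 * coneMap K n h := by
  classical
  induction h using MvPolynomial.induction_on' with
  | monomial e c =>
    rw [X, monomial_mul, coneMap_monomial, coneMap_monomial, one_mul]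
    by_cases he : IsMaxDegree n e
    · rw [if_pos he, if_pos (hX e he), Polynomial.X_pow_mul_monomial]
      simp [Finsupp.weight_single, add_comm]
    · rw [if_neg he, if_neg fun h => he h.of_add, mul_zero]
  | add p q hp hq => rw [mul_add, map_add, map_add, mul_add, hp, hq]

/-- Through `coneMap`, `X 0` acts as `t ^ n 0`, so torsion-freeness over `K[X 0]` is inherited from
the domain `K[t]`. -/
theorem coneMap_aeval_mul (hX : ∀ e, IsMaxDegree n e → IsMaxDegree n (Finsupp.single 0 1 + e))
    (g : Polynomial K) (h : MvPolynomial (Fin 4) K) :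
    coneMap K n (Polynomial.aeval (X 0) g * h) = Polynomial.expand K (n 0) g * coneMap K n h := by
  induction g using Polynomial.induction_on' with
  | add p q hp hq => rw [map_add, map_add, add_mul, add_mul, map_add, hp, hq]
  | monomial k c =>
    rw [← Polynomial.C_mul_X_pow_eq_monomial]
    simp only [map_mul, map_pow, Polynomial.aeval_C, Polynomial.aeval_X, Polynomial.expand_C,
      Polynomial.expand_X, algebraMap_eq]
    rw [mul_assoc, mul_assoc, ← smul_eq_C_mul, map_smul, ← Polynomial.smul_eq_C_mul]
    congr 1
    induction k with
    | zero => simp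
    | succ k ih => rw [pow_succ', mul_assoc, coneMap_X_mul hX, ih, pow_succ', mul_assoc]

theorem isCohenMacaulay_tangentCone (hn : ∀ i, 0 < n i) (hmin : ∀ i, n 0 ≤ n i)
    (hX : ∀ e, IsMaxDegree n e → IsMaxDegree n (Finsupp.single 0 1 + e)) :
    IsCohenMacaulay (MvPolynomial (Fin 4) K ⧸ tangentConeIdeal (curveIdeal K n)) := by
  set J := tangentConeIdeal (curveIdeal K n) with hJ
  let φ : Polynomial K →+* MvPolynomial (Fin 4) K ⧸ J :=
    (Ideal.Quotient.mk J).comp (Polynomial.aeval (R := K) (X 0 : MvPolynomial (Fin 4) K)).toRingHom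
  refine isCohenMacaulay_of_isIntegral_polynomial φ ?_ ?_
  · intro z
    obtain ⟨q, rfl⟩ := Ideal.Quotient.mk_surjective z
    induction q using MvPolynomial.induction_on with
    | C a =>
      have : Ideal.Quotient.mk J (C a) = φ (Polynomial.C a) := by simp [φ, algebraMap_eq]
      rw [this]
      exact φ.isIntegralElem_map
    | add p q hp hq => rw [map_add]; exact hp.add φ hq
    | mul_X p i hp =>
      rw [map_mul]
      refine hp.mul φ ?_
      obtain ⟨c, hc⟩ := X_pow_sub_mem_tangentConeIdeal (K := K) hmin i
      refine ⟨Polynomial.X ^ n 0 - Polynomial.C (Polynomial.C c * Polynomial.X ^ n 0),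
        Polynomial.monic_X_pow_sub_C _ (hn 0).ne', ?_⟩
      rw [← hJ, ← Ideal.Quotient.eq_zero_iff_mem] at hc
      rw [← hc, Polynomial.eval₂_sub, Polynomial.eval₂_pow, Polynomial.eval₂_X,
        Polynomial.eval₂_C]
      simp [φ, algebraMap_eq]
  · intro g hg z hz
    obtain ⟨h, rfl⟩ := Ideal.Quotient.mk_surjective z
    have hz' : Ideal.Quotient.mk J (Polynomial.aeval (X 0) g * h) = 0 := by
      rw [map_mul]; exact hz
    rw [Ideal.Quotient.eq_zero_iff_mem, hJ, mem_tangentConeIdeal_iff hn,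
      coneMap_aeval_mul hX] at hz'
    rw [Ideal.Quotient.eq_zero_iff_mem, hJ, mem_tangentConeIdeal_iff hn]
    refine (mul_eq_zero.1 hz').resolve_left ?_
    exact fun h0 => hg ((Polynomial.expand_eq_zero (hn 0)).1 h0)

theorem isMaxDegree_single_zero (hn : ∀ i, 0 < n i) (hmin : ∀ i, n 0 ≤ n i) (k : ℕ) :
    IsMaxDegree n (Finsupp.single 0 k) := by
  intro v hv
  have := degree_mul_le_weight hmin v
  rw [hv, Finsupp.weight_single, smul_eq_mul] at this
  simpa using Nat.le_of_mul_le_mul_right this (hn 0)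

/-- Nonconstant terms of `s` have positive weight, and powers of `X 0` have maximal degree since `n
0` is minimal. Used to see that the origin lies on the cone and that `X 0` is not nilpotent there.
-/
theorem coeff_coneMap_X_pow_mul (hn : ∀ i, 0 < n i) (hmin : ∀ i, n 0 ≤ n i) (k : ℕ)
    (s : MvPolynomial (Fin 4) K) :
    (coneMap K n (X 0 ^ k * s)).coeff (k * n 0) = constantCoeff s := by
  classical
  induction s using MvPolynomial.induction_on' with
  | monomial e c =>
    rw [X_pow_eq_monomial, monomial_mul, one_mul, coneMap_monomial, constantCoeff_monomial]
    by_cases he : e = 0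
    · subst he
      rw [add_zero, if_pos (isMaxDegree_single_zero hn hmin k), if_pos rfl,
        Finsupp.weight_single, smul_eq_mul, Polynomial.coeff_monomial_same]
    · rw [if_neg he]
      split_ifs
      · rw [Polynomial.coeff_monomial, if_neg]
        intro hw
        rw [map_add, Finsupp.weight_single, smul_eq_mul, Nat.add_eq_left] at hw
        exact he (eq_zero_of_weight_eq_zero hn hw)
      · simp
  | add p q hp hq => rw [mul_add, map_add, Polynomial.coeff_add, hp, hq, map_add]

theorem tangentConeIdeal_le_ker_constantCoeff (hn : ∀ i, 0 < n i) (hmin : ∀ i, n 0 ≤ n i) :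
    tangentConeIdeal (curveIdeal K n) ≤ RingHom.ker (constantCoeff (R := K) (σ := Fin 4)) := by
  intro h hh
  rw [mem_tangentConeIdeal_iff hn] at hh
  have := coeff_coneMap_X_pow_mul hn hmin 0 h
  rw [pow_zero, one_mul, hh] at this
  exact this.symm

/-- The quotient has no socle at the origin (`hsoc`). If `X 0` kills `h`, so does each `X i ^ n 0`,
hence every monomial of large degree; absence of socle then lowers the degree step by step down to
the monomial 1. -/
theorem mem_tangentConeIdeal_of_X_mul_mem (hn : ∀ i, 0 < n i) (hmin : ∀ i, n 0 ≤ n i)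
    (hCM : IsCohenMacaulay (MvPolynomial (Fin 4) K ⧸ tangentConeIdeal (curveIdeal K n)))
    {h : MvPolynomial (Fin 4) K} (hh : X 0 * h ∈ tangentConeIdeal (curveIdeal K n)) :
    h ∈ tangentConeIdeal (curveIdeal K n) := by
  classical
  set J := tangentConeIdeal (curveIdeal K n) with hJ
  let ε : MvPolynomial (Fin 4) K ⧸ J →+* K :=
    Ideal.Quotient.lift J constantCoeff (tangentConeIdeal_le_ker_constantCoeff hn hmin)
  have hε : ∀ q, ε (Ideal.Quotient.mk J q) = constantCoeff q :=
    fun q => Ideal.Quotient.lift_mk _ _ _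
  have hmax : (RingHom.ker ε).IsMaximal :=
    RingHom.ker_isMaximal_of_surjective ε fun a => ⟨Ideal.Quotient.mk J (C a), by simp [hε]⟩
  have hsoc : ∀ q, (∀ i, X i * q ∈ J) → q ∈ J := by
    intro q hq
    rw [← Ideal.Quotient.eq_zero_iff_mem]
    refine hCM.eq_zero_of_maximal_mul_eq_zero (RingHom.ker ε)
      (x := Ideal.Quotient.mk J (X 0)) ?_ ?_ ?_
    · simp [RingHom.mem_ker, hε]
    · intro k s hs hsk
      obtain ⟨s, rfl⟩ := Ideal.Quotient.mk_surjective s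
      rw [RingHom.mem_ker, hε] at hs
      rw [← map_pow, ← map_mul, Ideal.Quotient.eq_zero_iff_mem, hJ, mem_tangentConeIdeal_iff hn,
        mul_comm] at hsk
      apply hs
      rw [← coeff_coneMap_X_pow_mul hn hmin k, hsk, Polynomial.coeff_zero]
    · intro y hy
      obtain ⟨y, rfl⟩ := Ideal.Quotient.mk_surjective y
      rw [RingHom.mem_ker, hε] at hy
      rw [← map_mul, Ideal.Quotient.eq_zero_iff_mem, y.as_sum, Finset.sum_mul]
      refine Ideal.sum_mem _ fun e he => ?_
      have he0 : e ≠ 0 := by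
        rintro rfl
        exact mem_support_iff.1 he hy
      obtain ⟨i, hi⟩ := Finsupp.ne_iff.1 he0
      have hle : Finsupp.single i 1 ≤ e := by
        rw [Finsupp.single_le_iff]
        exact Nat.one_le_iff_ne_zero.2 hi
      have : monomial e (coeff e y) =
          monomial (e - Finsupp.single i 1) (coeff e y) * X i := by
        rw [X, monomial_mul, mul_one, tsub_add_cancel_of_le hle]
      rw [this, mul_assoc]
      exact Ideal.mul_mem_left _ _ (hq i)
  have hpow : ∀ i, X i ^ n 0 * h ∈ J := by
    intro i
    obtain ⟨c, hc⟩ := X_pow_sub_mem_tangentConeIdeal (K := K) hmin i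
    have h0 : X 0 ^ n 0 * h ∈ J := by
      obtain ⟨m, hm⟩ := Nat.exists_eq_succ_of_ne_zero (hn 0).ne'
      rw [hm, pow_succ, mul_assoc]
      exact Ideal.mul_mem_left _ _ hh
    have := Ideal.add_mem _ (Ideal.mul_mem_right h _ hc) (Ideal.mul_mem_left _ (C c) h0)
    convert this using 1
    ring
  -- Pigeonhole over the four variables gives the bound `4 * n 0`.
  have hbig : ∀ e : Fin 4 →₀ ℕ, 4 * n 0 ≤ e.degree → monomial e (1 : K) * h ∈ J := by
    intro e he
    have : ∃ i, n 0 ≤ e i := by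
      by_contra! hlt
      have h0 := hlt 0
      have h1 := hlt 1
      have h2 := hlt 2
      have h3 := hlt 3
      rw [degree_fin_four] at he
      omega
    obtain ⟨i, hi⟩ := this
    have hle : Finsupp.single i (n 0) ≤ e := by rwa [Finsupp.single_le_iff]
    have : monomial e (1 : K) = monomial (e - Finsupp.single i (n 0)) 1 * X i ^ n 0 := by
      rw [X_pow_eq_monomial, monomial_mul, mul_one, tsub_add_cancel_of_le hle]
    rw [this, mul_assoc]
    exact Ideal.mul_mem_left _ _ (hpow i)
  have hall : ∀ k ≤ 4 * n 0, ∀ e : Fin 4 →₀ ℕ, 4 * n 0 - k ≤ e.degree →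
      monomial e (1 : K) * h ∈ J := by
    intro k
    induction k with
    | zero => exact fun _ e he => hbig e he
    | succ k ih =>
      intro hk e he
      refine hsoc _ fun i => ?_
      rw [← mul_assoc, X, monomial_mul, one_mul]
      refine ih (by omega) _ ?_
      rw [map_add, Finsupp.degree_single]
      omega
  simpa using hall _ le_rfl 0 (by simp)

theorem isMaxDegree_single_add (hn : ∀ i, 0 < n i) (hmin : ∀ i, n 0 ≤ n i)
    (hCM : IsCohenMacaulay (MvPolynomial (Fin 4) K ⧸ tangentConeIdeal (curveIdeal K n)))
    (k : ℕ) {e : Fin 4 →₀ ℕ} (he : IsMaxDegree n e) : IsMaxDegree n (Finsupp.single 0 k + e) := by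
  induction k with
  | zero => simpa using he
  | succ k ih =>
    by_contra hcon
    rw [← monomial_mem_tangentConeIdeal_iff (K := K) hn] at hcon
    have : monomial (Finsupp.single 0 (k + 1) + e) (1 : K) =
        X 0 * monomial (Finsupp.single 0 k + e) 1 := by
      rw [X, monomial_mul, mul_one, add_comm k 1, Finsupp.single_add, add_assoc]
    rw [this] at hcon
    exact (monomial_mem_tangentConeIdeal_iff hn).1
      (mem_tangentConeIdeal_of_X_mul_mem hn hmin hCM hcon) ih

end

/-! ### Numerical relations and the exponents of the five binomials -/

/-- The exponent vector `(a, b, c, d)`. -/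
noncomputable def exponent (a b c d : ℕ) : Fin 4 →₀ ℕ :=
  Finsupp.equivFunOnFinite.symm ![a, b, c, d]

@[simp] theorem exponent_zero (a b c d : ℕ) : exponent a b c d 0 = a := rfl
@[simp] theorem exponent_one (a b c d : ℕ) : exponent a b c d 1 = b := rfl
@[simp] theorem exponent_two (a b c d : ℕ) : exponent a b c d 2 = c := rfl
@[simp] theorem exponent_three (a b c d : ℕ) : exponent a b c d 3 = d := rfl

theorem exponent_ext {e v : Fin 4 →₀ ℕ} (h₀ : e 0 = v 0) (h₁ : e 1 = v 1) (h₂ : e 2 = v 2)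
    (h₃ : e 3 = v 3) : e = v := by
  ext i
  fin_cases i <;> assumption

theorem exponent_le {e v : Fin 4 →₀ ℕ} (h₀ : e 0 ≤ v 0) (h₁ : e 1 ≤ v 1) (h₂ : e 2 ≤ v 2)
    (h₃ : e 3 ≤ v 3) : e ≤ v := by
  intro i
  fin_cases i <;> assumption

theorem monomial_exponent {K : Type*} [Field K] (a b c d : ℕ) :
    monomial (exponent a b c d) (1 : K) = X 0 ^ a * X 1 ^ b * X 2 ^ c * X 3 ^ d := by
  simp only [X_pow_eq_monomial, monomial_mul, mul_one]
  have : exponent a b c d = Finsupp.single 0 a + Finsupp.single 1 b + Finsupp.single 2 c +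
      Finsupp.single 3 d := by
    apply exponent_ext <;> simp
  rw [this]

theorem degree_exponent (a b c d : ℕ) : (exponent a b c d).degree = a + b + c + d := by
  simp [degree_fin_four]

theorem weight_exponent (n : Fin 4 → ℕ) (a b c d : ℕ) :
    Finsupp.weight n (exponent a b c d) = a * n 0 + b * n 1 + c * n 2 + d * n 3 := by
  simp [weight_fin_four]

/-- The numerical data attached to a semigroup generated by `n 0, …, n 3` whose curve ideal contains
the binomials `curveBinomials`. -/
structure CurveData (α₂₁ α₁ α₂ α₃ α₄ : ℕ) (n : Fin 4 → ℕ) : Prop where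
  one_lt_α₂ : 1 < α₂
  one_lt_α₃ : 1 < α₃
  one_lt_α₄ : 1 < α₄
  α₂₁_pos : 0 < α₂₁
  α₂₁_lt : α₂₁ + 1 < α₁
  pos : ∀ i, 0 < n i
  gcd : Finset.univ.gcd n = 1
  card : n 0 = α₂ * (α₃ * (α₄ - 1)) + 1
  rel₁ : α₁ * n 0 = n 2 + (α₄ - 1) * n 3
  rel₂ : α₂ * n 1 = α₂₁ * n 0 + n 3
  rel₃ : α₃ * n 2 = (α₁ - α₂₁ - 1) * n 0 + n 1
  rel₄ : α₄ * n 3 = n 0 + (α₂ - 1) * n 1 + (α₃ - 1) * n 2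
  rel₅ : n 1 + (α₄ - 1) * n 3 = (α₂₁ + 1) * n 0 + (α₃ - 1) * n 2

theorem CurveData.of_formulas {α₂₁ α₁ α₂ α₃ α₄ : ℕ} {n : Fin 4 → ℕ}
    (hα₂ : 1 < α₂) (hα₃ : 1 < α₃) (hα₄ : 1 < α₄)
    (hα₂₁ : 0 < α₂₁) (hα₂₁' : α₂₁ + 1 < α₁)
    (hn₁ : n 0 = α₂ * α₃ * (α₄ - 1) + 1)
    (hn₂ : n 1 = α₂₁ * α₃ * α₄ + (α₁ - α₂₁ - 1) * (α₃ - 1) + α₃)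
    (hn₃ : n 2 = α₁ * α₄ + (α₁ - α₂₁ - 1) * (α₂ - 1) * (α₄ - 1) - α₄ + 1)
    (hn₄ : n 3 = α₁ * α₂ * (α₃ - 1) + α₂₁ * (α₂ - 1) + α₂)
    (hgcd : Finset.univ.gcd n = 1) : CurveData α₂₁ α₁ α₂ α₃ α₄ n := by
  -- Parametrizing by the slack in each inequality removes truncated subtraction, so that the five
  -- relations become `ring` identities.
  obtain ⟨p, rfl⟩ := Nat.exists_eq_add_of_lt hα₂₁'
  obtain ⟨a₂, rfl⟩ := Nat.exists_eq_add_of_lt hα₂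
  obtain ⟨a₃, rfl⟩ := Nat.exists_eq_add_of_lt hα₃
  obtain ⟨a₄, rfl⟩ := Nat.exists_eq_add_of_lt hα₄
  have e₂ : 1 + a₂ + 1 - 1 = a₂ + 1 := by omega
  have e₃ : 1 + a₃ + 1 - 1 = a₃ + 1 := by omega
  have e₄ : 1 + a₄ + 1 - 1 = a₄ + 1 := by omega
  have e₁ : α₂₁ + 1 + p + 1 - α₂₁ - 1 = p + 1 := by omega
  rw [e₁, e₂, e₄] at hn₃
  have hn₃' : n 2 = (α₂₁ + 1 + p) * (a₄ + 2) + (p + 1) * (a₂ + 1) * (a₄ + 1) + 1 := by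
    rw [hn₃, Nat.add_right_cancel_iff]
    apply Nat.sub_eq_of_eq_add
    ring
  rw [e₄] at hn₁
  rw [e₁, e₃] at hn₂
  rw [e₂, e₃] at hn₄
  refine ⟨hα₂, hα₃, hα₄, hα₂₁, hα₂₁', ?_, hgcd, ?_, ?_, ?_, ?_, ?_, ?_⟩
  · intro i
    fin_cases i
    · change 0 < n 0
      rw [hn₁]; positivity
    · change 0 < n 1
      rw [hn₂]; positivity
    · change 0 < n 2
      rw [hn₃']; positivity
    · change 0 < n 3
      rw [hn₄]; positivity
  all_goals
    simp only [e₁, e₂, e₃, e₄, hn₁, hn₂, hn₃', hn₄]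
    ring

/-- Exponents of the monomials outside the ideal generated by the leading monomials of
`curveBinomials`. -/
def IsStandard (α₂ α₃ α₄ : ℕ) (e : Fin 4 →₀ ℕ) : Prop :=
  e 1 < α₂ ∧ e 2 < α₃ ∧ (e 3 < α₄ - 1 ∨ e 3 = α₄ - 1 ∧ e 1 = 0 ∧ e 2 = 0)

/-- The exponents of the terms of `curveBinomials` in which the first variable does not occur. -/
noncomputable def leadExponent (α₂ α₃ α₄ : ℕ) : Fin 5 → (Fin 4 →₀ ℕ) :=
  ![exponent 0 0 1 (α₄ - 1), exponent 0 α₂ 0 0, exponent 0 0 α₃ 0, exponent 0 0 0 α₄,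
    exponent 0 1 0 (α₄ - 1)]

/-- The exponents of the terms of `curveBinomials` in which the first variable occurs. -/
noncomputable def tailExponent (α₂₁ α₁ α₂ α₃ : ℕ) : Fin 5 → (Fin 4 →₀ ℕ) :=
  ![exponent α₁ 0 0 0, exponent α₂₁ 0 0 1, exponent (α₁ - α₂₁ - 1) 1 0 0,
    exponent 1 (α₂ - 1) (α₃ - 1) 0, exponent (α₂₁ + 1) 0 (α₃ - 1) 0]

theorem exists_leadExponent_le {α₂ α₃ α₄ : ℕ} {e : Fin 4 →₀ ℕ} (he : ¬ IsStandard α₂ α₃ α₄ e) :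
    ∃ i, leadExponent α₂ α₃ α₄ i ≤ e := by
  unfold IsStandard at he
  by_cases h₁ : α₂ ≤ e 1
  · exact ⟨1, exponent_le (Nat.zero_le _) h₁ (Nat.zero_le _) (Nat.zero_le _)⟩
  by_cases h₂ : α₃ ≤ e 2
  · exact ⟨2, exponent_le (Nat.zero_le _) (Nat.zero_le _) h₂ (Nat.zero_le _)⟩
  by_cases h₃ : α₄ ≤ e 3
  · exact ⟨3, exponent_le (Nat.zero_le _) (Nat.zero_le _) (Nat.zero_le _) h₃⟩
  by_cases h₄ : e 2 = 0
  · exact ⟨4, exponent_le (Nat.zero_le _) (show 1 ≤ e 1 by omega) (Nat.zero_le _)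
      (show α₄ - 1 ≤ e 3 by omega)⟩
  · exact ⟨0, exponent_le (Nat.zero_le _) (Nat.zero_le _) (show 1 ≤ e 2 by omega)
      (show α₄ - 1 ≤ e 3 by omega)⟩

theorem leadExponent_zero (α₂ α₃ α₄ : ℕ) (i : Fin 5) : leadExponent α₂ α₃ α₄ i 0 = 0 := by
  fin_cases i <;> rfl

theorem curveBinomials_eq {K : Type*} [Field K] (α₂₁ α₁ α₂ α₃ α₄ : ℕ) (i : Fin 5) :
    curveBinomials K α₂₁ α₁ α₂ α₃ α₄ i =
        monomial (leadExponent α₂ α₃ α₄ i) 1 - monomial (tailExponent α₂₁ α₁ α₂ α₃ i) 1 ∨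
      curveBinomials K α₂₁ α₁ α₂ α₃ α₄ i =
        monomial (tailExponent α₂₁ α₁ α₂ α₃ i) 1 - monomial (leadExponent α₂ α₃ α₄ i) 1 := by
  fin_cases i
  · right
    simp [curveBinomials, leadExponent, tailExponent, monomial_exponent]
  · left
    simp [curveBinomials, leadExponent, tailExponent, monomial_exponent]
  · left
    simp [curveBinomials, leadExponent, tailExponent, monomial_exponent]
  · left
    simp [curveBinomials, leadExponent, tailExponent, monomial_exponent]
  · right
    simp [curveBinomials, leadExponent, tailExponent, monomial_exponent, mul_comm]

theorem leadExponent_not_le {α₂ α₃ α₄ : ℕ} (hα₂ : 1 < α₂) (hα₃ : 1 < α₃) (hα₄ : 1 < α₄)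
    {i j : Fin 5} (hij : i ≠ j) : ¬ leadExponent α₂ α₃ α₄ i ≤ leadExponent α₂ α₃ α₄ j := by
  intro h
  have h₁ := h 1
  have h₂ := h 2
  have h₃ := h 3
  fin_cases i <;> fin_cases j <;> simp [leadExponent] at hij h₁ h₂ h₃ <;> omega

theorem exists_weight_cast_eq {n : Fin 4 → ℕ} (hn : ∀ i, 0 < n i) (hgcd : Finset.univ.gcd n = 1)
    (z : ZMod (n 0)) : ∃ e : Fin 4 →₀ ℕ, (Finsupp.weight n e : ZMod (n 0)) = z := by
  have : NeZero (n 0) := ⟨(hn 0).ne'⟩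
  obtain ⟨c, hc⟩ := Finset.gcd_eq_sum_mul Finset.univ (fun i => (n i : ℤ))
  have hg : (Finset.univ.gcd fun i => (n i : ℤ)) = 1 := by
    have h1 : (Finset.univ.gcd fun i => (n i : ℤ)).natAbs ∣ Finset.univ.gcd n :=
      Finset.dvd_gcd fun i _ => by
        simpa using Int.natAbs_dvd_natAbs.2
          (Finset.gcd_dvd (f := fun i => (n i : ℤ)) (Finset.mem_univ i))
    rw [hgcd, Nat.dvd_one] at h1
    have h2 := Int.nonneg_iff_normalize_eq_self _ |>.1
      (Finset.normalize_gcd (s := Finset.univ) (f := fun i => (n i : ℤ)))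
    omega
  rw [hg] at hc
  have hc' := congrArg (Int.cast : ℤ → ZMod (n 0)) hc
  rw [Fin.sum_univ_four] at hc'
  push_cast at hc'
  -- Bézout coefficients may be negative; their multiples by `z` are replaced by nonnegative
  -- representatives mod `n 0`.
  refine ⟨exponent (z * c 0).val (z * c 1).val (z * c 2).val (z * c 3).val, ?_⟩
  rw [weight_exponent]
  push_cast
  simp only [ZMod.natCast_val, ZMod.cast_id', id]
  linear_combination (-z) * hc'

/-! ### Standard exponents and the three inequalities -/

namespace CurveData
variable {α₂₁ α₁ α₂ α₃ α₄ : ℕ} {n : Fin 4 → ℕ}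

theorem weight_leadExponent (h : CurveData α₂₁ α₁ α₂ α₃ α₄ n) (i : Fin 5) :
    Finsupp.weight n (leadExponent α₂ α₃ α₄ i) =
      Finsupp.weight n (tailExponent α₂₁ α₁ α₂ α₃ i) := by
  fin_cases i <;> simp [leadExponent, tailExponent, weight_exponent, h.rel₁, h.rel₂, h.rel₃,
    h.rel₄, h.rel₅]

theorem tailExponent_zero_pos (h : CurveData α₂₁ α₁ α₂ α₃ α₄ n) (i : Fin 5) :
    0 < tailExponent α₂₁ α₁ α₂ α₃ i 0 := by
  have := h.α₂₁_pos
  have := h.α₂₁_lt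
  fin_cases i <;> simp [tailExponent] <;> omega

theorem degree_leadExponent_le (h : CurveData α₂₁ α₁ α₂ α₃ α₄ n) (hmin : ∀ i, n 0 ≤ n i)
    (h₁ : α₂ ≤ α₂₁ + 1) (h₂ : α₂₁ + α₃ ≤ α₁) (h₃ : α₄ ≤ α₂ + α₃ - 1) (i : Fin 5) :
    (leadExponent α₂ α₃ α₄ i).degree ≤ (tailExponent α₂₁ α₁ α₂ α₃ i).degree := by
  have hα₄ := h.one_lt_α₄
  -- The condition for `f₁` is automatic: its terms have weight `α₁ * n 0`, and the one of degree
  -- `α₄` weighs at least `α₄ * n 0`. The condition for `f₅` follows from `h₁` and `h₃`.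
  have h₄ : α₄ ≤ α₁ := by
    have := degree_mul_le_weight hmin (exponent 0 0 1 (α₄ - 1))
    rw [degree_exponent, weight_exponent] at this
    simp only [zero_mul, zero_add, one_mul, ← h.rel₁] at this
    have := Nat.le_of_mul_le_mul_right this (h.pos 0)
    omega
  have := h.α₂₁_lt
  have := h.one_lt_α₂
  have := h.one_lt_α₃
  fin_cases i <;> simp [leadExponent, tailExponent, degree_exponent] <;> omega

/-- Replacing a lead exponent by its tail keeps the weight and strictly raises the exponent of `X
0`, which the weight bounds; so rewriting terminates. -/
theorem exists_standard (h : CurveData α₂₁ α₁ α₂ α₃ α₄ n) (e : Fin 4 →₀ ℕ) :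
    ∃ v, IsStandard α₂ α₃ α₄ v ∧ Finsupp.weight n v = Finsupp.weight n e ∧
      (v = e ∨ e 0 < v 0) ∧
      ((∀ i, (leadExponent α₂ α₃ α₄ i).degree ≤ (tailExponent α₂₁ α₁ α₂ α₃ i).degree) →
        e.degree ≤ v.degree) := by
  induction hN : Finsupp.weight n e - e 0 using Nat.strong_induction_on generalizing e with
  | _ N ih =>
    by_cases he : IsStandard α₂ α₃ α₄ e
    · exact ⟨e, he, rfl, Or.inl rfl, fun _ => le_rfl⟩
    · obtain ⟨i, hi⟩ := exists_leadExponent_le he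
      obtain ⟨u, rfl⟩ := exists_add_of_le hi
      set v := tailExponent α₂₁ α₁ α₂ α₃ i + u with hv
      have hw : Finsupp.weight n v = Finsupp.weight n (leadExponent α₂ α₃ α₄ i + u) := by
        rw [hv, map_add, map_add, h.weight_leadExponent]
      have h0 : (leadExponent α₂ α₃ α₄ i + u) 0 < v 0 := by
        have := h.tailExponent_zero_pos i
        rw [hv, Finsupp.add_apply, Finsupp.add_apply, leadExponent_zero]
        omega
      have hle : v 0 ≤ Finsupp.weight n v :=
        (Finsupp.le_degree 0 v).trans (degree_le_weight h.pos v)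
      obtain ⟨s, hs, hsw, hs0, hsd⟩ := ih _ (by omega) v rfl
      refine ⟨s, hs, hsw.trans hw, Or.inr ?_, fun hd => le_trans ?_ (hsd hd)⟩
      · rcases hs0 with rfl | hs0 <;> omega
      · rw [hv, map_add, map_add]
        exact Nat.add_le_add_right (hd i) _

/-- A count: the last three coordinates of standard exponents lie in a set of `α₂ * α₃ * (α₄ - 1) +
1 = n 0` triples, which surjects onto `ZMod (n 0)` by rewriting and the gcd condition, hence
bijectively. The weight then fixes the exponent of `X 0`. -/
theorem standard_unique (h : CurveData α₂₁ α₁ α₂ α₃ α₄ n) {e v : Fin 4 →₀ ℕ}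
    (he : IsStandard α₂ α₃ α₄ e) (hv : IsStandard α₂ α₃ α₄ v)
    (hw : Finsupp.weight n e = Finsupp.weight n v) : e = v := by
  classical
  have : NeZero (n 0) := ⟨(h.pos 0).ne'⟩
  let T : Finset (ℕ × ℕ × ℕ) :=
    insert (0, 0, α₄ - 1) (Finset.range α₂ ×ˢ Finset.range α₃ ×ˢ Finset.range (α₄ - 1))
  let F : ℕ × ℕ × ℕ → ZMod (n 0) := fun t => t.1 * n 1 + t.2.1 * n 2 + t.2.2 * n 3
  have hα₂ := h.one_lt_α₂
  have hα₃ := h.one_lt_α₃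
  have hmem : ∀ e, IsStandard α₂ α₃ α₄ e → (e 1, e 2, e 3) ∈ T := by
    intro e he
    simp only [T, Finset.mem_insert, Finset.mem_product, Finset.mem_range, Prod.mk.injEq]
    obtain ⟨h1, h2, h3⟩ := he
    omega
  have hF : ∀ e : Fin 4 →₀ ℕ, F (e 1, e 2, e 3) = (Finsupp.weight n e : ZMod (n 0)) := by
    intro e
    simp [F, weight_fin_four]
  have hcard : T.card = n 0 := by
    rw [Finset.card_insert_of_notMem (by simp), h.card]
    simp
  have hsurj : Set.SurjOn F T (Finset.univ : Finset (ZMod (n 0))) := by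
    intro z _
    obtain ⟨e, he⟩ := exists_weight_cast_eq h.pos h.gcd z
    obtain ⟨s, hs, hsw, -⟩ := h.exists_standard e
    exact ⟨_, hmem s hs, by rw [hF, hsw, he]⟩
  have hinj : Set.InjOn F T :=
    Finset.injOn_of_surjOn_of_card_le F (fun _ _ => by simp) hsurj
      (by rw [hcard, Finset.card_univ, ZMod.card])
  have heq := hinj (hmem e he) (hmem v hv) (by rw [hF, hF, hw])
  simp only [Prod.mk.injEq] at heq
  obtain ⟨h1, h2, h3⟩ := heq
  refine exponent_ext ?_ h1 h2 h3
  rw [weight_fin_four, weight_fin_four, h1, h2, h3] at hw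
  exact Nat.eq_of_mul_eq_mul_right (h.pos 0) (by omega)

/-- Any other exponent of this weight would rewrite to `e` with a strictly larger exponent of `X 0`,
which is 0: `e` is alone in its weight. -/
theorem isMaxDegree_of_isStandard (h : CurveData α₂₁ α₁ α₂ α₃ α₄ n) {e : Fin 4 →₀ ℕ}
    (he : IsStandard α₂ α₃ α₄ e) (he0 : e 0 = 0) : IsMaxDegree n e := by
  intro v hv
  obtain ⟨s, hs, hsw, hs0, -⟩ := h.exists_standard v
  obtain rfl := h.standard_unique hs he (hsw.trans hv)
  rcases hs0 with rfl | hs0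
  · rfl
  · omega

/-- By uniqueness, any competitor rewrites, without loss of degree, to `X 0` times the standard form
of `e`, whose degree is at most that of `e`. -/
theorem isMaxDegree_single_add (h : CurveData α₂₁ α₁ α₂ α₃ α₄ n)
    (hd : ∀ i, (leadExponent α₂ α₃ α₄ i).degree ≤ (tailExponent α₂₁ α₁ α₂ α₃ i).degree)
    {e : Fin 4 →₀ ℕ} (he : IsMaxDegree n e) : IsMaxDegree n (Finsupp.single 0 1 + e) := by
  intro v hv
  obtain ⟨s, hs, hsw, -, -⟩ := h.exists_standard e
  obtain ⟨u, hu, huw, -, hud⟩ := h.exists_standard v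
  have hs' : IsStandard α₂ α₃ α₄ (Finsupp.single 0 1 + s) := by
    simpa [IsStandard] using hs
  have heq : u = Finsupp.single 0 1 + s :=
    h.standard_unique hu hs' (by rw [huw, hv, map_add, map_add, hsw])
  have h1 := hud hd
  have h2 := he s hsw
  rw [heq, map_add] at h1
  rw [map_add]
  omega

theorem le_of_isMaxDegree (h : CurveData α₂₁ α₁ α₂ α₃ α₄ n)
    (hX : ∀ k e, IsMaxDegree n e → IsMaxDegree n (Finsupp.single 0 k + e)) :
    α₂ ≤ α₂₁ + 1 ∧ α₂₁ + α₃ ≤ α₁ ∧ α₄ ≤ α₂ + α₃ - 1 := by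
  have hα₂ := h.one_lt_α₂
  have hα₃ := h.one_lt_α₃
  have hα₄ := h.one_lt_α₄
  have hα₁ := h.α₂₁_lt
  -- The tails of `f₂`, `f₃`, `f₄` are powers of `X 0` times standard monomials free of `X 0`, so
  -- they have maximal degree and bound the degrees of their lead terms; these bounds are the three
  -- inequalities.
  have key : ∀ i k b c d, IsStandard α₂ α₃ α₄ (exponent 0 b c d) →
      tailExponent α₂₁ α₁ α₂ α₃ i = exponent k b c d →
      (leadExponent α₂ α₃ α₄ i).degree ≤ k + b + c + d := by
    intro i k b c d hst htail
    have hmax := hX k _ (h.isMaxDegree_of_isStandard hst rfl)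
    have hsum : Finsupp.single 0 k + exponent 0 b c d = exponent k b c d := by
      apply exponent_ext <;> simp
    rw [hsum] at hmax
    have := hmax _ ((h.weight_leadExponent i).trans (by rw [htail]))
    rwa [degree_exponent] at this
  have h₁ := key 1 α₂₁ 0 0 1 (by simp [IsStandard]; omega) rfl
  have h₂ := key 2 (α₁ - α₂₁ - 1) 1 0 0 (by simp [IsStandard]; omega) rfl
  have h₃ := key 3 1 (α₂ - 1) (α₃ - 1) 0 (by simp [IsStandard]; omega) rfl
  simp only [leadExponent, Matrix.cons_val, degree_exponent] at h₁ h₂ h₃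
  omega

end CurveData

/-! ### Leading monomials and the standard basis -/

theorem negDegRevLexLT_of_degree_le {σ : Equiv.Perm (Fin 4)} (hσ : σ 0 = 0) {a b : Fin 4 →₀ ℕ}
    (hd : b.degree ≤ a.degree) (h0 : b 0 < a 0) : NegDegRevLexLT σ a b := by
  rcases hd.lt_or_eq with hd | hd
  · exact Or.inl hd
  · exact Or.inr ⟨hd.symm, 0, h0, fun j hj => by simp [hσ] at hj⟩

theorem not_negDegRevLexLT_of_degree_le {σ : Equiv.Perm (Fin 4)} (hσ : σ 0 = 0)
    {a b : Fin 4 →₀ ℕ} (hd : b.degree ≤ a.degree) (h0 : b 0 < a 0) : ¬ NegDegRevLexLT σ b a := by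
  rintro (h | ⟨-, i, hi, hj⟩)
  · omega
  · by_cases hi0 : i = 0
    · subst hi0
      omega
    · have : σ 0 < σ i := by
        rw [hσ, Fin.pos_iff_ne_zero, ← hσ]
        exact fun h => hi0 (σ.injective h)
      exact h0.ne (hj 0 this)

section
variable {K : Type*} [Field K]

theorem mem_support_curveBinomials {α₂₁ α₁ α₂ α₃ α₄ : ℕ} {n : Fin 4 → ℕ}
    (h : CurveData α₂₁ α₁ α₂ α₃ α₄ n) (i : Fin 5) (e : Fin 4 →₀ ℕ) :
    e ∈ (curveBinomials K α₂₁ α₁ α₂ α₃ α₄ i).support ↔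
      e = leadExponent α₂ α₃ α₄ i ∨ e = tailExponent α₂₁ α₁ α₂ α₃ i := by
  classical
  have hne : leadExponent α₂ α₃ α₄ i ≠ tailExponent α₂₁ α₁ α₂ α₃ i := by
    intro heq
    have h1 := h.tailExponent_zero_pos i
    rw [← heq, leadExponent_zero] at h1
    exact h1.false
  rw [mem_support_iff]
  rcases curveBinomials_eq (K := K) α₂₁ α₁ α₂ α₃ α₄ i with hi | hi <;>
  · rw [hi, coeff_sub, coeff_monomial, coeff_monomial]
    by_cases h1 : leadExponent α₂ α₃ α₄ i = e
    · subst h1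
      simp [hne.symm]
    · by_cases h2 : tailExponent α₂₁ α₁ α₂ α₃ i = e
      · subst h2
        simp [hne]
      · simp [h1, h2, Ne.symm h1, Ne.symm h2]

theorem isLeadingExponent_curveBinomials_iff {α₂₁ α₁ α₂ α₃ α₄ : ℕ} {n : Fin 4 → ℕ}
    (h : CurveData α₂₁ α₁ α₂ α₃ α₄ n)
    (hd : ∀ i, (leadExponent α₂ α₃ α₄ i).degree ≤ (tailExponent α₂₁ α₁ α₂ α₃ i).degree)
    {σ : Equiv.Perm (Fin 4)} (hσ : σ 0 = 0) (i : Fin 5) (a : Fin 4 →₀ ℕ) :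
    IsLeadingExponent σ (curveBinomials K α₂₁ α₁ α₂ α₃ α₄ i) a ↔ a = leadExponent α₂ α₃ α₄ i := by
  have h0 : leadExponent α₂ α₃ α₄ i 0 < tailExponent α₂₁ α₁ α₂ α₃ i 0 := by
    rw [leadExponent_zero]
    exact h.tailExponent_zero_pos i
  simp only [IsLeadingExponent, mem_support_curveBinomials h]
  constructor
  · rintro ⟨rfl | rfl, hlt⟩
    · rfl
    · by_contra hne
      exact not_negDegRevLexLT_of_degree_le hσ (hd i) h0 (hlt _ (Or.inl rfl) (Ne.symm hne))
  · rintro rfl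
    refine ⟨Or.inl rfl, ?_⟩
    rintro b (rfl | rfl) hb
    · exact (hb rfl).elim
    · exact negDegRevLexLT_of_degree_le hσ (hd i) h0

/-- If `a` were standard, every other exponent of its weight would rewrite to `a` without loss of
degree and with a gain in `X 0`, hence be larger in the order and absent from `f`. Then `a` would be
the only term of its weight, impossible in the curve ideal. -/
theorem not_isStandard_of_isLeadingExponent {α₂₁ α₁ α₂ α₃ α₄ : ℕ} {n : Fin 4 → ℕ}
    (h : CurveData α₂₁ α₁ α₂ α₃ α₄ n)
    (hd : ∀ i, (leadExponent α₂ α₃ α₄ i).degree ≤ (tailExponent α₂₁ α₁ α₂ α₃ i).degree)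
    {σ : Equiv.Perm (Fin 4)} (hσ : σ 0 = 0) {f : MvPolynomial (Fin 4) K}
    (hf : f ∈ curveIdeal K n) {a : Fin 4 →₀ ℕ} (ha : IsLeadingExponent σ f a) :
    ¬ IsStandard α₂ α₃ α₄ a := by
  intro hst
  have hz := sum_coeff_eq_zero_of_mem_curveIdeal hf (Finsupp.weight n a)
  rw [Finset.sum_eq_single a] at hz
  · rw [if_pos rfl] at hz
    exact mem_support_iff.1 ha.1 hz
  · intro e he hea
    refine if_neg fun hw => ?_
    obtain ⟨s, hs, hsw, hs0, hsd⟩ := h.exists_standard e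
    obtain rfl := h.standard_unique hs hst (hsw.trans hw)
    exact not_negDegRevLexLT_of_degree_le hσ (hsd hd) (hs0.resolve_left (Ne.symm hea))
      (ha.2 e he hea)
  · exact fun hna => (hna ha.1).elim

theorem curveBinomials_mem_curveIdeal {α₂₁ α₁ α₂ α₃ α₄ : ℕ} {n : Fin 4 → ℕ}
    (h : CurveData α₂₁ α₁ α₂ α₃ α₄ n) (i : Fin 5) :
    curveBinomials K α₂₁ α₁ α₂ α₃ α₄ i ∈ curveIdeal K n := by
  rcases curveBinomials_eq (K := K) α₂₁ α₁ α₂ α₃ α₄ i with hi | hi <;> rw [hi]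
  · exact monomial_sub_monomial_mem_curveIdeal (h.weight_leadExponent i)
  · exact monomial_sub_monomial_mem_curveIdeal (h.weight_leadExponent i).symm

theorem isMinimalStandardBasis_curveBinomials {α₂₁ α₁ α₂ α₃ α₄ : ℕ} {n : Fin 4 → ℕ}
    (h : CurveData α₂₁ α₁ α₂ α₃ α₄ n)
    (hd : ∀ i, (leadExponent α₂ α₃ α₄ i).degree ≤ (tailExponent α₂₁ α₁ α₂ α₃ i).degree)
    {σ : Equiv.Perm (Fin 4)} (hσ : σ 0 = 0) :
    IsMinimalStandardBasis σ (curveBinomials K α₂₁ α₁ α₂ α₃ α₄) (curveIdeal K n) where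
  mem := curveBinomials_mem_curveIdeal h
  ne_zero i h0 := by
    have := (mem_support_curveBinomials (K := K) h i _).2 (Or.inl rfl)
    rw [h0] at this
    simp at this
  leadingIdeal_eq := by
    apply le_antisymm
    · refine Ideal.span_mono ?_
      rintro m ⟨_, ⟨i, rfl⟩, a, ha, rfl⟩
      exact ⟨_, curveBinomials_mem_curveIdeal h i, a, ha, rfl⟩
    · refine Ideal.span_le.2 ?_
      rintro m ⟨f, hf, a, ha, rfl⟩
      obtain ⟨i, hi⟩ := exists_leadExponent_le (not_isStandard_of_isLeadingExponent h hd hσ hf ha)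
      have : monomial a (1 : K) =
          monomial (a - leadExponent α₂ α₃ α₄ i) 1 * monomial (leadExponent α₂ α₃ α₄ i) 1 := by
        rw [monomial_mul, mul_one, tsub_add_cancel_of_le hi]
      rw [this]
      exact Ideal.mul_mem_left _ _ (Ideal.subset_span
        ⟨_, ⟨i, rfl⟩, _, (isLeadingExponent_curveBinomials_iff h hd hσ i _).2 rfl, rfl⟩)
  not_dvd i j hij a b ha hb := by
    rw [isLeadingExponent_curveBinomials_iff h hd hσ] at ha hb
    rw [ha, hb, monomial_dvd_monomial]
    rintro ⟨hle | hle, -⟩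
    · exact one_ne_zero hle
    · exact leadExponent_not_le h.one_lt_α₂ h.one_lt_α₃ h.one_lt_α₄ hij hle

end

theorem theorem3p5 (K : Type*) [Field K] (α₂₁ α₁ α₂ α₃ α₄ : ℕ) (n : Fin 4 → ℕ)
    (hα₁ : 1 < α₁) (hα₂ : 1 < α₂) (hα₃ : 1 < α₃) (hα₄ : 1 < α₄)
    (hα₂₁ : 0 < α₂₁) (hα₂₁' : α₂₁ + 1 < α₁)
    (hn₁ : n 0 = α₂ * α₃ * (α₄ - 1) + 1)
    (hn₂ : n 1 = α₂₁ * α₃ * α₄ + (α₁ - α₂₁ - 1) * (α₃ - 1) + α₃)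
    (hn₃ : n 2 = α₁ * α₄ + (α₁ - α₂₁ - 1) * (α₂ - 1) * (α₄ - 1) - α₄ + 1)
    (hn₄ : n 3 = α₁ * α₂ * (α₃ - 1) + α₂₁ * (α₂ - 1) + α₂)
    (hgcd : Finset.univ.gcd n = 1)
    (hmin : ∀ i, n 0 ≤ n i) :
    (IsCohenMacaulay (MvPolynomial (Fin 4) K ⧸ tangentConeIdeal (curveIdeal K n)) ↔
      α₂ ≤ α₂₁ + 1 ∧ α₂₁ + α₃ ≤ α₁ ∧ α₄ ≤ α₂ + α₃ - 1) ∧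
    (IsCohenMacaulay (MvPolynomial (Fin 4) K ⧸ tangentConeIdeal (curveIdeal K n)) →
      ∀ σ : Equiv.Perm (Fin 4), σ 0 = 0 →
        IsMinimalStandardBasis σ (curveBinomials K α₂₁ α₁ α₂ α₃ α₄) (curveIdeal K n)) := by
  have h : CurveData α₂₁ α₁ α₂ α₃ α₄ n :=
    .of_formulas hα₂ hα₃ hα₄ hα₂₁ hα₂₁' hn₁ hn₂ hn₃ hn₄ hgcd
  have hnec (hCM : IsCohenMacaulay (MvPolynomial (Fin 4) K ⧸ tangentConeIdeal (curveIdeal K n))) :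
      α₂ ≤ α₂₁ + 1 ∧ α₂₁ + α₃ ≤ α₁ ∧ α₄ ≤ α₂ + α₃ - 1 :=
    h.le_of_isMaxDegree fun k _ he => isMaxDegree_single_add h.pos hmin hCM k he
  refine ⟨⟨hnec, fun ⟨h₁, h₂, h₃⟩ => ?_⟩, fun hCM σ hσ => ?_⟩
  · exact isCohenMacaulay_tangentCone h.pos hmin fun _ he =>
      h.isMaxDegree_single_add (h.degree_leadExponent_le hmin h₁ h₂ h₃) he
  · obtain ⟨h₁, h₂, h₃⟩ := hnec hCM
    exact isMinimalStandardBasis_curveBinomials h (h.degree_leadExponent_le hmin h₁ h₂ h₃) hσ
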